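/- For a natural number $d\ge 1$ let $B_2^d$ be the closed unit ball of the Euclidean norm $\|\cdot\|$ on $\mathbb{R}^d$, and for a finite set $U\subset\mathbb{R}^d$ write $s(U)=\sum_{u\in U}u$ (so $s(\emptyset)=0$). For an integer $k\ge 0$ let $T(B_2^d,k)\in[0,\infty]$ be the smallest constant $C$ such that every finite set $V\subset B_2^d$ with $s(V)=0$ and $k\le |V|$ has a subset $U\subset V$ with $|U|=k$ and $\|s(U)\|\le C$; put $T(B_2^d)=\sup_{k\ge 0}T(B_2^d,k)$. Then $$\tfrac12\sqrt{d+2}\;\le\; T(B_2^d)\;\le\;\frac{1+\sqrt5}{2}\sqrt d .$$ The same two inequalities hold when $V$ and $U$ are allowed to be multisets, that is, when vectors may be repeated in $V$ and cardinalities, sums and inclusions are taken with multiplicity. -/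

import Mathlib

open scoped ENNReal

namespace SubsetSums

/-- `C` bounds the `k`-element subset sums for finite sets in the unit ball of `E`: every finite
set `V` of vectors of norm at most `1` with `s(V) = 0` and `k ≤ |V|` has a subset `U` with
`|U| = k` and `‖s(U)‖ ≤ C`. -/
def SetBound (E : Type*) [NormedAddCommGroup E] (k : ℕ) (C : ℝ≥0∞) : Prop :=
  ∀ V : Finset E, (∀ v ∈ V, v ∈ Metric.closedBall (0 : E) 1) → ∑ v ∈ V, v = 0 → k ≤ V.card →
    ∃ U : Finset E, U ⊆ V ∧ U.card = k ∧ ‖∑ u ∈ U, u‖ₑ ≤ C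

/-- The same property for multisets of vectors (a vector may occur in several copies). -/
def MultisetBound (E : Type*) [NormedAddCommGroup E] (k : ℕ) (C : ℝ≥0∞) : Prop :=
  ∀ V : Multiset E, (∀ v ∈ V, v ∈ Metric.closedBall (0 : E) 1) → V.sum = 0 → k ≤ V.card →
    ∃ U : Multiset E, U ≤ V ∧ U.card = k ∧ ‖U.sum‖ₑ ≤ C

/-- `T(B, k)`, for `B` the closed unit ball of `E`: the smallest admissible constant. Values in
`[0, ∞]`, so that infima and suprema carry no default values. -/
noncomputable def TSetAt (E : Type*) [NormedAddCommGroup E] (k : ℕ) : ℝ≥0∞ :=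
  sInf {C | SetBound E k C}

/-- `T(B) = sup_k T(B, k)`. -/
noncomputable def TSet (E : Type*) [NormedAddCommGroup E] : ℝ≥0∞ :=
  ⨆ k : ℕ, TSetAt E k

/-- `T(B, k)` with multisets in place of sets. -/
noncomputable def TMultisetAt (E : Type*) [NormedAddCommGroup E] (k : ℕ) : ℝ≥0∞ :=
  sInf {C | MultisetBound E k C}

/-- `T(B)` with multisets in place of sets. -/
noncomputable def TMultiset (E : Type*) [NormedAddCommGroup E] : ℝ≥0∞ :=
  ⨆ k : ℕ, TMultisetAt E k

/-- The infimum is attained: `TSetAt E k` is the smallest admissible constant. -/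
theorem isLeast_TSetAt (E : Type*) [NormedAddCommGroup E] (k : ℕ) :
    IsLeast {C | SetBound E k C} (TSetAt E k) := by
  refine ⟨fun V hV hs hk => ?_, fun C hC => sInf_le hC⟩
  obtain ⟨U, hU, hmin⟩ := Finset.exists_min_image (V.powersetCard k) (fun U => ‖∑ u ∈ U, u‖ₑ)
    (Finset.powersetCard_nonempty.2 hk)
  rw [Finset.mem_powersetCard] at hU
  refine ⟨U, hU.1, hU.2, le_sInf fun C hC => ?_⟩
  obtain ⟨U', h1, h2, h3⟩ := hC V hV hs hk
  exact (hmin U' (Finset.mem_powersetCard.2 ⟨h1, h2⟩)).trans h3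

/-- The infimum is attained: `TMultisetAt E k` is the smallest admissible constant. -/
theorem isLeast_TMultisetAt (E : Type*) [NormedAddCommGroup E] (k : ℕ) :
    IsLeast {C | MultisetBound E k C} (TMultisetAt E k) := by
  classical
  refine ⟨fun V hV hs hk => ?_, fun C hC => sInf_le hC⟩
  have hne : (V.powersetCard k).toFinset.Nonempty := by
    have hpos : 0 < (V.powersetCard k).card := by
      rw [Multiset.card_powersetCard]
      exact Nat.choose_pos hk
    obtain ⟨U, hU⟩ := Multiset.card_pos_iff_exists_mem.1 hpos
    exact ⟨U, Multiset.mem_toFinset.2 hU⟩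
  obtain ⟨U, hU, hmin⟩ := Finset.exists_min_image _ (fun U : Multiset E => ‖U.sum‖ₑ) hne
  rw [Multiset.mem_toFinset, Multiset.mem_powersetCard] at hU
  refine ⟨U, hU.1, hU.2, le_sInf fun C hC => ?_⟩
  obtain ⟨U', h1, h2, h3⟩ := hC V hV hs hk
  exact (hmin U' (by simp [Multiset.mem_powersetCard, h1, h2])).trans h3

end SubsetSums

/-! Upper bound: replace a `k`-subset by weights in the unit cube of total `k`, and use that
`fractionality` is strictly concave, so that minimisers are pushed towards vertices. Minimising it
subject to a vanishing weighted sum leaves at most `d + 1` fractional coordinates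
(`exists_balanced_weights`), hence `fractionality` at most `(d + 1) / 4`. Dropping the vanishing
constraint and minimising the squared norm plus `3 * fractionality` gives a `0`-`1` vector
(`exists_rounding`), whence the bound `√(3 / 4 * (d + 1))`, stronger than the one claimed. Lower
bound: for the vertices of a regular simplex, the norm of a subset sum depends only on the
cardinality, so no choice of subset helps. -/

namespace SubsetSums

/-! ### Upper bound: balanced fractional weights and their rounding. -/

section Rounding

variable {ι E : Type*} [Fintype ι] [NormedAddCommGroup E] [InnerProductSpace ℝ E]

/-- The total fractionality of a vector of weights; it vanishes at `0`-`1` vectors. -/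
def fractionality (α : ι → ℝ) : ℝ := ∑ i, α i * (1 - α i)

/-- The weights in the unit cube with total `k`. -/
def weights (ι : Type*) [Fintype ι] (k : ℕ) : Set (ι → ℝ) :=
  {α | (∀ i, α i ∈ Set.Icc (0 : ℝ) 1) ∧ ∑ i, α i = k}

theorem isCompact_weights (k : ℕ) : IsCompact (weights ι k) := by
  have h : weights ι k = Set.Icc 0 1 ∩ {α | ∑ i, α i = (k : ℝ)} := by
    ext α
    simp [weights, Pi.le_def, forall_and]
  rw [h]
  exact isCompact_Icc.inter_right (isClosed_eq (by fun_prop) (by fun_prop))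

theorem continuous_fractionality : Continuous (fractionality : (ι → ℝ) → ℝ) := by
  unfold fractionality
  fun_prop

/-- Strict concavity in quantitative form: a minimiser admits no nonzero direction that is feasible
both ways. -/
theorem fractionality_add_add_fractionality_sub (α w : ι → ℝ) :
    fractionality (α + w) + fractionality (α - w) = 2 * fractionality α - 2 * ∑ i, w i ^ 2 := by
  simp only [fractionality, Finset.mul_sum, ← Finset.sum_add_distrib, ← Finset.sum_sub_distrib,
    Pi.add_apply, Pi.sub_apply]
  exact Finset.sum_congr rfl fun i _ => by ring

theorem fractionality_le (α : ι → ℝ) (hα : ∀ i, α i ∈ Set.Icc (0 : ℝ) 1) :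
    fractionality α ≤ (Finset.univ.filter fun i => α i ∈ Set.Ioo (0 : ℝ) 1).card / 4 := by
  classical
  rw [fractionality, ← Finset.sum_filter_add_sum_filter_not _ (fun i => α i ∈ Set.Ioo (0 : ℝ) 1)]
  have h0 : ∑ i with ¬ α i ∈ Set.Ioo (0 : ℝ) 1, α i * (1 - α i) = 0 := by
    refine Finset.sum_eq_zero fun i hi => ?_
    have h1 := hα i
    simp only [Finset.mem_filter, Finset.mem_univ, true_and, Set.mem_Ioo, not_and, not_lt] at hi
    rcases h1.1.eq_or_lt with h | h
    · simp [← h]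
    · simp [le_antisymm h1.2 (hi h)]
  rw [h0, add_zero, div_eq_mul_inv, ← nsmul_eq_mul]
  exact Finset.sum_le_card_nsmul _ _ _ fun i _ => by nlinarith [sq_nonneg (2 * α i - 1)]

/-- A direction supported on the fractional coordinates can be followed both ways. -/
theorem exists_perturbation (α w : ι → ℝ) (hα : ∀ i, α i ∈ Set.Icc (0 : ℝ) 1)
    (hw : ∀ i, w i ≠ 0 → α i ∈ Set.Ioo (0 : ℝ) 1) :
    ∃ ε : ℝ, 0 < ε ∧ ∀ i, α i + ε * w i ∈ Set.Icc (0 : ℝ) 1 ∧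
      α i - ε * w i ∈ Set.Icc (0 : ℝ) 1 := by
  have key : ∀ᶠ ε in nhds (0 : ℝ), ∀ i, α i + ε * w i ∈ Set.Icc (0 : ℝ) 1 ∧
      α i - ε * w i ∈ Set.Icc (0 : ℝ) 1 := by
    refine Filter.eventually_all.2 fun i => ?_
    by_cases h : w i = 0
    · simpa [h] using hα i
    have hi := Icc_mem_nhds (hw i h).1 (hw i h).2
    have c1 : ContinuousAt (fun ε : ℝ => α i + ε * w i) 0 := by fun_prop
    have c2 : ContinuousAt (fun ε : ℝ => α i - ε * w i) 0 := by fun_prop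
    exact (c1.eventually_mem (by simpa using hi)).and (c2.eventually_mem (by simpa using hi))
  obtain ⟨ε, h, hε⟩ := ((key.filter_mono nhdsWithin_le_nhds).and
    (self_mem_nhdsWithin : Set.Ioi (0 : ℝ) ∈ nhdsWithin 0 (Set.Ioi 0))).exists
  exact ⟨ε, hε, h⟩

/-- The balanced weights with few fractional coordinates. -/
theorem exists_balanced_weights [FiniteDimensional ℝ E] (v : ι → E) (hv : ∑ i, v i = 0)
    {k : ℕ} (hk : k ≤ Fintype.card ι) :
    ∃ α ∈ weights ι k, ∑ i, α i • v i = 0 ∧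
      (Finset.univ.filter fun i => α i ∈ Set.Ioo (0 : ℝ) 1).card ≤ Module.finrank ℝ E + 1 := by
  classical
  obtain ⟨α, ⟨⟨hα, hαk⟩, hαv⟩, hmin⟩ : ∃ α ∈ weights ι k ∩ {α | ∑ i, α i • v i = 0},
      IsMinOn fractionality (weights ι k ∩ {α | ∑ i, α i • v i = 0}) α := by
    refine ((isCompact_weights k).inter_right
      (isClosed_eq (by fun_prop) (by fun_prop))).exists_isMinOn ?_
      continuous_fractionality.continuousOn
    rcases Nat.eq_zero_or_pos (Fintype.card ι) with h0 | h0
    · have : IsEmpty ι := Fintype.card_eq_zero_iff.1 h0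
      exact ⟨0, ⟨by simp, by simp [show k = 0 by omega]⟩, by simp⟩
    · have h0' : (0 : ℝ) < Fintype.card ι := by exact_mod_cast h0
      refine ⟨fun _ => k / Fintype.card ι, ⟨fun i => ⟨by positivity, ?_⟩, ?_⟩, ?_⟩
      · exact (div_le_one h0').2 (by exact_mod_cast hk)
      · simp; field_simp
      · simp [← Finset.smul_sum, hv]
  refine ⟨α, ⟨hα, hαk⟩, hαv, ?_⟩
  by_contra! hcard
  set F := Finset.univ.filter fun i => α i ∈ Set.Ioo (0 : ℝ) 1 with hF
  -- The second component records the total weight, so a kernel vector preserves both constraints;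
  -- the target has dimension `finrank + 1`.
  let L : (F → ℝ) →ₗ[ℝ] E × ℝ :=
    (Fintype.linearCombination ℝ fun i : F => (v i, (1 : ℝ)))
  have hker : L.ker ≠ ⊥ := by
    apply LinearMap.ker_ne_bot_of_finrank_lt
    simpa using hcard
  obtain ⟨w, hw, hw0⟩ := (Submodule.ne_bot_iff _).1 hker
  let W : ι → ℝ := fun i => if h : i ∈ F then w ⟨i, h⟩ else 0
  have hW : ∑ i, W i • (v i, (1 : ℝ)) = 0 := by
    have hL : ∑ i : F, w i • (v i, (1 : ℝ)) = 0 := by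
      simpa [L, Fintype.linearCombination_apply] using hw
    rw [← hL, ← Finset.sum_subset (Finset.subset_univ F), ← Finset.sum_coe_sort F]
    · exact Finset.sum_congr rfl fun i _ => by simp [W]
    · intro i _ hi
      simp [W, hi]
  have hW1 : ∑ i, W i = 0 := by simpa [Prod.snd_sum] using congrArg Prod.snd hW
  have hWv : ∑ i, W i • v i = 0 := by simpa [Prod.fst_sum] using congrArg Prod.fst hW
  have hWpos : 0 < ∑ i, W i ^ 2 := by
    obtain ⟨j, hj⟩ := Function.ne_iff.1 hw0
    refine Finset.sum_pos' (fun i _ => sq_nonneg _) ⟨j, Finset.mem_univ _, ?_⟩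
    have : W j = w j := by simp [W]
    rw [this]
    exact sq_pos_iff.2 hj
  obtain ⟨ε, hε, hb⟩ := exists_perturbation α W hα fun i hi => by
    by_contra hni
    exact hi (dif_neg (by simpa [hF] using hni))
  have h1 : α + ε • W ∈ weights ι k ∩ {α | ∑ i, α i • v i = 0} := by
    refine ⟨⟨fun i => (hb i).1, ?_⟩, ?_⟩
    · simp [Finset.sum_add_distrib, ← Finset.mul_sum, hW1, hαk]
    · simp only [Set.mem_ofPred_eq] at hαv
      simp [add_smul, Finset.sum_add_distrib, mul_smul, ← Finset.smul_sum, hWv, hαv]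
  have h2 : α - ε • W ∈ weights ι k ∩ {α | ∑ i, α i • v i = 0} := by
    refine ⟨⟨fun i => (hb i).2, ?_⟩, ?_⟩
    · simp [Finset.sum_sub_distrib, ← Finset.mul_sum, hW1, hαk]
    · simp only [Set.mem_ofPred_eq] at hαv
      simp [sub_smul, Finset.sum_sub_distrib, mul_smul, ← Finset.smul_sum, hWv, hαv]
  have h3 := fractionality_add_add_fractionality_sub α (ε • W)
  have h4 : ∑ i, (ε • W) i ^ 2 = ε ^ 2 * ∑ i, W i ^ 2 := by
    simp [mul_pow, Finset.mul_sum]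
  have h5 := hmin h1
  have h6 := hmin h2
  simp only [Set.mem_ofPred_eq] at h5 h6
  have h7 : 0 < ε ^ 2 * ∑ i, W i ^ 2 := by positivity
  linarith

/-- Weights can be rounded to the indicator of a set of the same total. -/
theorem exists_rounding (v : ι → E) (hv : ∀ i, ‖v i‖ ≤ 1) {k : ℕ} {α₀ : ι → ℝ}
    (hα₀ : α₀ ∈ weights ι k) :
    ∃ S : Finset ι, S.card = k ∧
      ‖∑ i ∈ S, v i‖ ^ 2 ≤ ‖∑ i, α₀ i • v i‖ ^ 2 + 3 * fractionality α₀ := by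
  classical
  -- Along `e_i - e_j` the squared norm has second-order coefficient `‖v i - v j‖ ^ 2 ≤ 4` and
  -- `fractionality` has `-2`; any factor above `2` makes `Φ` strictly concave there.
  let Φ : (ι → ℝ) → ℝ := fun α => ‖∑ i, α i • v i‖ ^ 2 + 3 * fractionality α
  have hΦ : Continuous Φ := by
    have := continuous_fractionality (ι := ι)
    fun_prop
  obtain ⟨α, ⟨hα, hαk⟩, hmin⟩ := (isCompact_weights k).exists_isMinOn ⟨α₀, hα₀⟩ hΦ.continuousOn
  have hint : ∀ i, α i ∉ Set.Ioo (0 : ℝ) 1 := by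
    intro i hi
    -- The total `k` is an integer, so a fractional coordinate cannot be alone.
    obtain ⟨j, hji, hj⟩ : ∃ j, j ≠ i ∧ α j ∈ Set.Ioo (0 : ℝ) 1 := by
      by_contra! h
      have h01 : ∀ j ∈ Finset.univ.erase i, α j = ((if α j = 1 then 1 else 0 : ℕ) : ℝ) := by
        intro j hj
        have h1 := h j (Finset.ne_of_mem_erase hj)
        split_ifs with hj1
        · simpa using hj1
        · by_contra h0
          exact h1 ⟨lt_of_le_of_ne (hα j).1 (by simpa using Ne.symm h0),
            lt_of_le_of_ne (hα j).2 hj1⟩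
      rw [← Finset.add_sum_erase _ _ (Finset.mem_univ i), Finset.sum_congr rfl h01,
        ← Nat.cast_sum] at hαk
      set m := ∑ j ∈ Finset.univ.erase i, if α j = 1 then 1 else 0
      have h1 : (m : ℝ) < k := by linarith [hi.1]
      have h2 : (k : ℝ) < m + 1 := by linarith [hi.2]
      norm_cast at h1 h2
      omega
    let W : ι → ℝ := Pi.single i 1 - Pi.single j 1
    obtain ⟨ε, hε, hb⟩ := exists_perturbation α W hα fun l hl => by
      by_cases hli : l = i
      · exact hli ▸ hi
      by_cases hlj : l = j
      · exact hlj ▸ hj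
      simp [W, hli, hlj] at hl
    have hW1 : ∑ l, W l = 0 := by simp [W]
    have hWv : ∑ l, W l • v l = v i - v j := by
      simp [W, sub_smul, Pi.single_apply]
    have hW2 : ∑ l, W l ^ 2 = 2 := by
      have : ∀ l, W l ^ 2 = (if l = i then 1 else 0) + if l = j then 1 else 0 := by
        intro l
        by_cases hli : l = i
        · subst hli
          simp [W, hji.symm]
        · by_cases hlj : l = j <;> simp [W, hli, hlj, hji]
      simp [this, Finset.sum_add_distrib]
      norm_num
    have h1 : α + ε • W ∈ weights ι k :=
      ⟨fun l => (hb l).1, by simp [Finset.sum_add_distrib, ← Finset.mul_sum, hW1, hαk]⟩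
    have h2 : α - ε • W ∈ weights ι k :=
      ⟨fun l => (hb l).2, by simp [Finset.sum_sub_distrib, ← Finset.mul_sum, hW1, hαk]⟩
    have h3 := fractionality_add_add_fractionality_sub α (ε • W)
    have h4 : ∑ l, (ε • W) l ^ 2 = ε ^ 2 * 2 := by
      simp [mul_pow, ← Finset.mul_sum, hW2]
    have h5 : Φ α ≤ Φ (α + ε • W) := hmin h1
    have h6 : Φ α ≤ Φ (α - ε • W) := hmin h2
    have h7 : ∑ l, (α + ε • W) l • v l = ∑ l, α l • v l + ε • (v i - v j) := by
      simp only [← hWv, Pi.add_apply, Pi.smul_apply, add_smul, Finset.sum_add_distrib,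
        smul_assoc, ← Finset.smul_sum]
    have h8 : ∑ l, (α - ε • W) l • v l = ∑ l, α l • v l - ε • (v i - v j) := by
      simp only [← hWv, Pi.sub_apply, Pi.smul_apply, sub_smul, Finset.sum_sub_distrib,
        smul_assoc, ← Finset.smul_sum]
    have h9 := parallelogram_law_with_norm ℝ (∑ l, α l • v l) (ε • (v i - v j))
    have h10 : ‖v i - v j‖ ≤ 2 := by linarith [norm_sub_le (v i) (v j), hv i, hv j]
    have h11 : ‖ε • (v i - v j)‖ ^ 2 ≤ ε ^ 2 * 4 := by
      rw [norm_smul, mul_pow, Real.norm_eq_abs, sq_abs]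
      gcongr
      nlinarith [norm_nonneg (v i - v j)]
    have h12 : 0 < ε ^ 2 := by positivity
    simp only [Φ, h7, h8] at h5 h6
    nlinarith
  have h01 : ∀ i, α i = if α i = 1 then 1 else 0 := by
    intro i
    split_ifs with h
    · exact h
    · by_contra h0
      exact hint i ⟨lt_of_le_of_ne (hα i).1 (Ne.symm h0), lt_of_le_of_ne (hα i).2 h⟩
  refine ⟨Finset.univ.filter fun i => α i = 1, ?_, ?_⟩
  · rw [Finset.sum_congr rfl fun i _ => h01 i] at hαk
    simpa using hαk
  · have h1 : ∑ i, α i • v i = ∑ i with α i = 1, v i := by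
      rw [Finset.sum_congr rfl fun i _ => congrArg (· • v i) (h01 i)]
      simp [ite_smul, Finset.sum_filter]
    have h2 : fractionality α = 0 := by
      refine Finset.sum_eq_zero fun i _ => ?_
      rw [h01 i]
      split_ifs <;> simp
    have h3 : Φ α ≤ Φ α₀ := hmin hα₀
    simpa [Φ, h1, h2] using h3

/-- A balanced family in the unit ball has small `k`-term subsums. -/
theorem exists_small_subsum [FiniteDimensional ℝ E] (v : ι → E) (hv : ∀ i, ‖v i‖ ≤ 1)
    (hs : ∑ i, v i = 0) {k : ℕ} (hk : k ≤ Fintype.card ι) :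
    ∃ S : Finset ι, S.card = k ∧ ‖∑ i ∈ S, v i‖ ^ 2 ≤ 3 / 4 * (Module.finrank ℝ E + 1) := by
  obtain ⟨α, hα, hαv, hcard⟩ := exists_balanced_weights v hs hk
  obtain ⟨S, hS, h⟩ := exists_rounding v hv hα
  refine ⟨S, hS, h.trans ?_⟩
  have h1 := fractionality_le α hα.1
  have h2 : ((Finset.univ.filter fun i => α i ∈ Set.Ioo (0 : ℝ) 1).card : ℝ) ≤
    Module.finrank ℝ E + 1 := by exact_mod_cast hcard
  rw [hαv, norm_zero]
  linarith

end Rounding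
end SubsetSums

/-! ### Sets against multisets, and the lower bound from the regular simplex. -/

namespace SubsetSums

theorem TSet_le_TMultiset (E : Type*) [NormedAddCommGroup E] : TSet E ≤ TMultiset E := by
  refine iSup_mono fun k => sInf_le_sInf fun C hC V hV hs hk => ?_
  obtain ⟨U, hU, hUk, hUC⟩ := hC V.val (by simpa using hV) (by simpa using hs) (by simpa using hk)
  refine ⟨⟨U, Multiset.nodup_of_le hU V.nodup⟩, Finset.val_le_iff.1 hU, hUk, ?_⟩
  simpa [Finset.sum] using hUC

/-- The unit vectors from the centre of a regular simplex to its vertices. -/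
theorem exists_regular_simplex (d : ℕ) (hd : 1 ≤ d) :
    ∃ v : Fin (d + 1) → EuclideanSpace ℝ (Fin d), ∀ S : Finset (Fin (d + 1)),
      ‖∑ i ∈ S, v i‖ ^ 2 = (S.card * (d + 1 - S.card) / d : ℝ) := by
  classical
  have hd' : (0 : ℝ) < d := by exact_mod_cast hd
  let e : EuclideanSpace ℝ (Fin (d + 1)) := WithLp.toLp 2 fun _ => 1
  have he : e ≠ 0 := fun h => by
    have := congrArg (fun x : EuclideanSpace ℝ (Fin (d + 1)) => x 0) h
    simp [e] at this
  -- The standard basis projected orthogonally to the all-ones vector has squared norms `d / (d +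
  -- 1)`; `c` rescales them to `1`.
  let c : ℝ := √((d + 1) / d)
  have hc : c ^ 2 = (d + 1) / d := Real.sq_sqrt (by positivity)
  let w : Fin (d + 1) → EuclideanSpace ℝ (Fin (d + 1)) := fun i =>
    WithLp.toLp 2 fun j => c * ((if j = i then 1 else 0) - 1 / (d + 1))
  have hw : ∀ i, w i ∈ (ℝ ∙ e)ᗮ := by
    intro i
    rw [Submodule.mem_orthogonal_singleton_iff_inner_right]
    simp [PiLp.inner_apply, e, w, ← Finset.mul_sum, Finset.sum_sub_distrib]
    right
    field_simp
    ring
  have : Fact (Module.finrank ℝ (EuclideanSpace ℝ (Fin (d + 1))) = d + 1) := ⟨by simp⟩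
  let b : OrthonormalBasis (Fin d) ℝ (ℝ ∙ e)ᗮ :=
    (stdOrthonormalBasis ℝ (ℝ ∙ e)ᗮ).reindex
      (finCongr (Submodule.finrank_orthogonal_span_singleton he))
  refine ⟨fun i => b.repr ⟨w i, hw i⟩, fun S => ?_⟩
  rw [← map_sum, LinearIsometryEquiv.norm_map, Submodule.coe_norm, Submodule.coe_sum,
    EuclideanSpace.real_norm_sq_eq]
  have h1 : ∀ j, (∑ i ∈ S, w i) j ^ 2 = c ^ 2 * ((if j ∈ S then 1 - 2 * (S.card / (d + 1) : ℝ)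
      else 0) + (S.card / (d + 1)) ^ 2) := by
    intro j
    have : (∑ i ∈ S, w i) j = c * ((if j ∈ S then 1 else 0) - S.card / (d + 1)) := by
      simp [w, ← Finset.mul_sum, Finset.sum_sub_distrib]
      left
      ring
    rw [this]
    split_ifs <;> ring
  simp only [h1, ← Finset.mul_sum, Finset.sum_add_distrib, hc]
  simp
  field_simp
  ring

theorem le_TSet_euclideanSpace (d : ℕ) (hd : 1 ≤ d) :
    ENNReal.ofReal (1 / 2 * √((d : ℝ) + 2)) ≤ TSet (EuclideanSpace ℝ (Fin d)) := by
  classical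
  have hd' : (0 : ℝ) < d := by exact_mod_cast hd
  obtain ⟨v, hv⟩ := exists_regular_simplex d hd
  have hnorm : ∀ i, ‖v i‖ = 1 := fun i => by
    have h := hv {i}
    simp only [Finset.sum_singleton, Finset.card_singleton, Nat.cast_one] at h
    rw [← sq_eq_sq₀ (norm_nonneg _) zero_le_one, h]
    field_simp
    ring
  have hinj : Function.Injective v := by
    intro i j hij
    by_contra hne
    have h := hv {i, j}
    rw [Finset.sum_pair hne, Finset.card_pair hne, hij, ← two_smul ℝ, norm_smul, hnorm] at h
    field_simp at h
    norm_num at h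
    linarith
  -- Half of the vertices maximises `k * (d + 1 - k)`; for even `d` the resulting bound is an
  -- equality.
  set k := (d + 1) / 2 with hk
  refine le_trans (le_sInf fun C hC => ?_) (le_iSup (TSetAt _) k)
  obtain ⟨U, hU, hUk, hUC⟩ := hC (Finset.univ.image v) (by simp [hnorm])
    (by
      rw [Finset.sum_image hinj.injOn]
      have h := hv Finset.univ
      simpa using h)
    (by rw [Finset.card_image_of_injective _ hinj]; simp; omega)
  obtain ⟨S, -, rfl⟩ := Finset.subset_image_iff.1 hU
  rw [Finset.card_image_of_injective _ hinj] at hUk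
  rw [Finset.sum_image hinj.injOn] at hUC
  refine le_trans ?_ hUC
  rw [← ofReal_norm]
  refine ENNReal.ofReal_le_ofReal (abs_le_of_sq_le_sq' ?_ (norm_nonneg _)).2
  rw [mul_pow, Real.sq_sqrt (by positivity), hv S, hUk, le_div_iff₀ hd']
  rcases Nat.even_or_odd' d with ⟨m, rfl | rfl⟩
  · have : k = m := by omega
    rw [this]
    push_cast
    nlinarith
  · have : k = m + 1 := by omega
    rw [this]
    push_cast
    nlinarith

end SubsetSums

/-! ### Upper bound for multisets. -/

namespace SubsetSums

theorem TMultiset_le (E : Type*) [NormedAddCommGroup E] [InnerProductSpace ℝ E]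
    [FiniteDimensional ℝ E] :
    TMultiset E ≤ ENNReal.ofReal √(3 / 4 * (Module.finrank ℝ E + 1)) := by
  classical
  refine iSup_le fun k => sInf_le fun V hV hs hk => ?_
  -- Indexing by the occurrences in `V` turns multiplicities into distinct indices.
  obtain ⟨S, hS, h⟩ := exists_small_subsum (fun i : V => (i : E))
    (fun i => by simpa using hV i Multiset.coe_mem) (k := k)
    (by rw [Finset.sum, Multiset.map_univ_coe, hs]) (by simpa using hk)
  refine ⟨S.val.map fun i : V => (i : E), ?_, by simpa using hS, ?_⟩
  · conv_rhs => rw [← Multiset.map_univ_coe V]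
    exact Multiset.map_le_map (Finset.val_le_iff.2 (Finset.subset_univ S))
  · rw [← ofReal_norm]
    exact ENNReal.ofReal_le_ofReal (Real.le_sqrt_of_sq_le h)

theorem TMultiset_euclideanSpace_le (d : ℕ) (hd : 1 ≤ d) :
    TMultiset (EuclideanSpace ℝ (Fin d)) ≤ ENNReal.ofReal ((1 + √5) / 2 * √(d : ℝ)) := by
  refine (TMultiset_le _).trans (ENNReal.ofReal_le_ofReal ?_)
  have hd' : (1 : ℝ) ≤ d := by exact_mod_cast hd
  rw [finrank_euclideanSpace_fin]
  have h5 : 2 ≤ √5 := Real.le_sqrt_of_sq_le (by norm_num)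
  refine Real.sqrt_le_iff.2 ⟨by positivity, ?_⟩
  rw [mul_pow, Real.sq_sqrt (by positivity)]
  -- This suffices, since `3 / 4 * (d + 1) ≤ 3 / 2 * d ≤ 9 / 4 * d` for `d ≥ 1`.
  have : (3 / 2 : ℝ) ^ 2 ≤ ((1 + √5) / 2) ^ 2 := by gcongr; linarith
  nlinarith

end SubsetSums

theorem theorem4 (d : ℕ) (hd : 1 ≤ d) :
    (ENNReal.ofReal (1 / 2 * √((d : ℝ) + 2)) ≤ SubsetSums.TSet (EuclideanSpace ℝ (Fin d)) ∧
      SubsetSums.TSet (EuclideanSpace ℝ (Fin d)) ≤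
        ENNReal.ofReal ((1 + √5) / 2 * √(d : ℝ))) ∧
    (ENNReal.ofReal (1 / 2 * √((d : ℝ) + 2)) ≤ SubsetSums.TMultiset (EuclideanSpace ℝ (Fin d)) ∧
      SubsetSums.TMultiset (EuclideanSpace ℝ (Fin d)) ≤
        ENNReal.ofReal ((1 + √5) / 2 * √(d : ℝ))) :=
  ⟨⟨SubsetSums.le_TSet_euclideanSpace d hd,
    (SubsetSums.TSet_le_TMultiset _).trans (SubsetSums.TMultiset_euclideanSpace_le d hd)⟩,
    (SubsetSums.le_TSet_euclideanSpace d hd).trans (SubsetSums.TSet_le_TMultiset _),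
    SubsetSums.TMultiset_euclideanSpace_le d hd⟩
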